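/- **Conventions.** A finitary partial Horn theory $\mathbb T$ over an $S$-sorted finitary signature $\Sigma$ (a set of function symbols and a set of relation symbols with finite arities) is a set of sequents $\phi\vdash_{\vec x}\psi$ between finitary Horn formulas (finite conjunctions of formulas $R(\vec\tau)$ and $\tau=\tau'$) in the same finite context $\vec x$. A partial $\Sigma$-structure $M$ interprets each sort as a set, each function symbol as a partial map and each relation symbol as a subset; a term is defined only if all its subterms are, and $\tau=\tau'$ means that both sides are defined and equal. $M$ is a partial $\mathbb T$-model if all sequents of $\mathbb T$ are valid in $M$. $\mathbf{PMod}\,\mathbb T$ is the category of partial $\mathbb T$-models and $\Sigma$-homomorphisms (families of total maps that preserve relations, and definedness and values of function symbols). A theory morphism $\rho\colon\mathbb S\to\mathbb T$ sends sorts to sorts, function symbols to terms and relation symbols to Horn formulas (in the corresponding contexts), in such a way that the $\rho$-translation of each sequent of $\mathbb S$ is a theorem of $\mathbb T$ in partial Horn logic; here the translation of a formula includes the requirement that the translations of all terms and subterms occurring in it are defined. It induces a functor $U^\rho\colon\mathbf{PMod}\,\mathbb T\to\mathbf{PMod}\,\mathbb S$. A monomorphism $m\colon A\to B$ in $\mathbf{PMod}\,\mathbb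 T$ is *$\mathbb T$-closed* if for each function symbol $f$ and relation symbol $R$ the domain of $f$ in $A$ and the subset $R$ in $A$ are the preimages under $m$ of those in $B$. A morphism $p\colon X\to Y$ of a category is an *$\aleph_0$-local retraction* if each morphism from a finitely presentable object to $Y$ factors through $p$; $p$ in $\mathbf{PMod}\,\mathbb T$ is a *$(U^\rho,\aleph_0)$-local retraction*, and $Y$ a *$(U^\rho,\aleph_0)$-local retract* of $X$, if $U^\rho p$ is an $\aleph_0$-local retraction in $\mathbf{PMod}\,\mathbb S$. A finitary partial Horn theory $\mathbb S$ *admits filtered colimit elimination* if, for each finitary partial Horn theory $\mathbb T$ and each theory morphism $\rho\colon\mathbb S\to\mathbb T$, each replete full subcategory of $\mathbf{PMod}\,\mathbb T$ that is closed under small products, $\mathbb T$-closed subobjects and $(U^\rho,\aleph_0)$-local retracts is also closed under small filtered colimits. A category satisfies the *ascending chain condition* (ACC) if for each chain $X_0\to X_1\to X_2\to\cdots$ in it there is an $N$ such that for all $m,n\ge N$ there are morphisms $X_m\to X_n$ and $X_n\to X_m$. An object $C$ is *connected* if $\mathrm{Hom}(C,-)$ preserves small coproducts. **Theorem.** Let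 $\mathbb S$ be a finitary partial Horn theory that admits filtered colimit elimination. 1. The full subcategory of $\mathbf{PMod}\,\mathbb S$ consisting of all finitely presentable connected objects satisfies the ascending chain condition. 2. The morphism from the initial object to the terminal object of $\mathbf{PMod}\,\mathbb S$ is a strong monomorphism if and only if every non-initial object $X$ is the domain of two distinct parallel morphisms $X\rightrightarrows Y$ for some $Y$. If these equivalent conditions hold, then the full subcategory of $\mathbf{PMod}\,\mathbb S$ consisting of all finitely presentable objects satisfies the ascending chain condition. -/

import Mathlib

universe u

namespace PHL

open CategoryTheory CategoryTheory.Limits Opposite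

/-! ### Finitary partial Horn logic: signatures, terms, formulas, theories -/

/-- A finite list of sorts: the input type of a symbol, or a context `(x₀ : s₀, …, xₙ₋₁ : sₙ₋₁)` of
distinct variables.  The variables of a context are its positions, so contexts are taken
up to renaming of variables. -/
structure Ctx (S : Type u) : Type u where
  len : ℕ
  sort : Fin len → S

/-- Renaming the sorts of a context along a map of sorts. -/
abbrev Ctx.map {S S' : Type u} (Γ : Ctx S) (r : S → S') : Ctx S' := ⟨Γ.len, fun i => r (Γ.sort i)⟩

/-- An `S`-sorted finitary signature. -/
structure Signature (S : Type u) : Type (u + 1) where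
  Fn : Type u
  fnArity : Fn → Ctx S
  fnSort : Fn → S
  Rel : Type u
  relArity : Rel → Ctx S

/-- `Term Sg Γ s`: terms of type `s` over `Sg` in the context `Γ`. -/
inductive Term {S : Type u} (Sg : Signature S) (Γ : Ctx S) : S → Type u
  | var {s : S} (i : Fin Γ.len) (h : Γ.sort i = s) : Term Sg Γ s
  | app (f : Sg.Fn) (ts : ∀ j : Fin (Sg.fnArity f).len, Term Sg Γ ((Sg.fnArity f).sort j)) :
      Term Sg Γ (Sg.fnSort f)

/-- `Horn Sg Γ`: finitary Horn formulas over `Sg` in the context `Γ`. -/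
inductive Horn {S : Type u} (Sg : Signature S) (Γ : Ctx S) : Type u
  | rel (R : Sg.Rel) (ts : ∀ j : Fin (Sg.relArity R).len, Term Sg Γ ((Sg.relArity R).sort j)) :
      Horn Sg Γ
  | eq {s : S} (t t' : Term Sg Γ s) : Horn Sg Γ
  | conj {n : ℕ} (φ : Fin n → Horn Sg Γ) : Horn Sg Γ

section Formulas

variable {S : Type u} {Sg : Signature S}

/-- The truth constant, i.e. the empty conjunction. -/
def Horn.top {Γ : Ctx S} : Horn Sg Γ := .conj (n := 0) Fin.elim0

/-- Binary conjunction. -/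
def Horn.and {Γ : Ctx S} (φ ψ : Horn Sg Γ) : Horn Sg Γ := .conj ![φ, ψ]

/-- `t ↓`, that is `t = t`. -/
def Term.defined {Γ : Ctx S} {s : S} (t : Term Sg Γ s) : Horn Sg Γ := .eq t t

/-- The conjunction of `τ i ↓` over all `i`. -/
def allDefined {Γ Δ : Ctx S} (τ : ∀ i : Fin Γ.len, Term Sg Δ (Γ.sort i)) : Horn Sg Δ :=
  .conj fun i => (τ i).defined

/-- Simultaneous substitution in terms. -/
def Term.subst {Γ Δ : Ctx S} (τ : ∀ i : Fin Γ.len, Term Sg Δ (Γ.sort i)) :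
    {s : S} → Term Sg Γ s → Term Sg Δ s
  | _, .var i h => h ▸ τ i
  | _, .app f ts => .app f fun j => (ts j).subst τ

/-- Simultaneous substitution in Horn formulas. -/
def Horn.subst {Γ Δ : Ctx S} (τ : ∀ i : Fin Γ.len, Term Sg Δ (Γ.sort i)) :
    Horn Sg Γ → Horn Sg Δ
  | .rel R ts => .rel R fun j => (ts j).subst τ
  | .eq t t' => .eq (t.subst τ) (t'.subst τ)
  | .conj φ => .conj fun i => (φ i).subst τ

end Formulas

/-- Horn sequents. -/
structure Sequent {S : Type u} (Sg : Signature S) : Type u where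
  ctx : Ctx S
  hyp : Horn Sg ctx
  concl : Horn Sg ctx

/-- A finitary partial Horn theory over `Sg`: a set of Horn sequents. -/
abbrev Theory {S : Type u} (Sg : Signature S) : Type u := Set (Sequent Sg)

/-- `Provable T φ ψ`: the sequent `φ ⊢ ψ` is a theorem of `T`, i.e. the root of a derivation
using the axioms in `T` and the inference rules of finitary partial Horn logic. -/
inductive Provable {S : Type u} {Sg : Signature S} (T : Theory Sg) :
    {Γ : Ctx S} → Horn Sg Γ → Horn Sg Γ → Prop
  | ax (σ : Sequent Sg) (h : σ ∈ T) : Provable T σ.hyp σ.concl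
  | id {Γ : Ctx S} (φ : Horn Sg Γ) : Provable T φ φ
  | cut {Γ : Ctx S} {φ ψ χ : Horn Sg Γ} (h₁ : Provable T φ ψ) (h₂ : Provable T ψ χ) :
      Provable T φ χ
  | subst {Γ Δ : Ctx S} {φ ψ : Horn Sg Γ} (τ : ∀ i : Fin Γ.len, Term Sg Δ (Γ.sort i))
      (h : Provable T φ ψ) : Provable T ((φ.subst τ).and (allDefined τ)) (ψ.subst τ)
  | refl {Γ : Ctx S} (i : Fin Γ.len) :
      Provable T Horn.top (Term.var (Sg := Sg) (Γ := Γ) i rfl).defined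
  | eq {Γ Δ : Ctx S} (φ : Horn Sg Γ) (x y : Fin Γ.len → Fin Δ.len)
      (hx : Function.Injective x) (hy : Function.Injective y)
      (sx : ∀ i, Δ.sort (x i) = Γ.sort i) (sy : ∀ i, Δ.sort (y i) = Γ.sort i) :
      Provable T
        ((φ.subst fun i => .var (x i) (sx i)).and
          (.conj fun i => .eq (.var (x i) (sx i)) (.var (y i) (sy i))))
        (φ.subst fun i => .var (y i) (sy i))
  | srel {Γ : Ctx S} (R : Sg.Rel)
      (ts : ∀ j : Fin (Sg.relArity R).len, Term Sg Γ ((Sg.relArity R).sort j))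
      (j : Fin (Sg.relArity R).len) : Provable T (.rel R ts) (ts j).defined
  | seqLeft {Γ : Ctx S} {s : S} (t t' : Term Sg Γ s) : Provable T (.eq t t') t.defined
  | seqRight {Γ : Ctx S} {s : S} (t t' : Term Sg Γ s) : Provable T (.eq t t') t'.defined
  | sfun {Γ : Ctx S} (f : Sg.Fn)
      (ts : ∀ j : Fin (Sg.fnArity f).len, Term Sg Γ ((Sg.fnArity f).sort j))
      (j : Fin (Sg.fnArity f).len) : Provable T (Term.app f ts).defined (ts j).defined
  | econj {Γ : Ctx S} {n : ℕ} (φ : Fin n → Horn Sg Γ) (j : Fin n) : Provable T (.conj φ) (φ j)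
  | iconj {Γ : Ctx S} {n : ℕ} {φ : Horn Sg Γ} {ψ : Fin n → Horn Sg Γ}
      (h : ∀ i, Provable T φ (ψ i)) : Provable T φ (.conj ψ)

/-! ### Partial structures and partial models -/

/-- Partial `Sg`-structures. -/
structure PStr {S : Type u} (Sg : Signature S) : Type (u + 1) where
  carrier : S → Type u
  fn (f : Sg.Fn) : (∀ i : Fin (Sg.fnArity f).len, carrier ((Sg.fnArity f).sort i)) →
    Part (carrier (Sg.fnSort f))
  rel (R : Sg.Rel) : Set (∀ i : Fin (Sg.relArity R).len, carrier ((Sg.relArity R).sort i))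

section Semantics

variable {S : Type u} {Sg : Signature S}

/-- Tuples of elements of `M` that interpret the variables of `Γ`. -/
abbrev PStr.Env (M : PStr Sg) (Γ : Ctx S) : Type u := ∀ i : Fin Γ.len, M.carrier (Γ.sort i)

/-- The interpretation of a term as a partial map. -/
def Term.eval (M : PStr Sg) {Γ : Ctx S} (m : M.Env Γ) :
    {s : S} → Term Sg Γ s → Part (M.carrier s)
  | _, .var i h => Part.some (h ▸ m i)
  | _, .app f ts =>
      Part.bind ⟨∀ j, ((ts j).eval M m).Dom, fun h j => ((ts j).eval M m).get (h j)⟩ (M.fn f)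

/-- The interpretation of a Horn formula as a subset. -/
def Horn.holds (M : PStr Sg) {Γ : Ctx S} (m : M.Env Γ) : Horn Sg Γ → Prop
  | .rel R ts => ∃ h : ∀ j, ((ts j).eval M m).Dom,
      (fun j => ((ts j).eval M m).get (h j)) ∈ M.rel R
  | .eq t t' => ∃ (h : (t.eval M m).Dom) (h' : (t'.eval M m).Dom),
      (t.eval M m).get h = (t'.eval M m).get h'
  | .conj φ => ∀ i, (φ i).holds M m

/-- Validity of a sequent in a partial structure. -/
def PStr.Satisfies (M : PStr Sg) {Γ : Ctx S} (φ ψ : Horn Sg Γ) : Prop :=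
  ∀ m : M.Env Γ, φ.holds M m → ψ.holds M m

/-- Homomorphisms of partial structures. -/
@[ext]
structure PStr.Hom (M N : PStr Sg) : Type u where
  toFun (s : S) : M.carrier s → N.carrier s
  map_fn (f : Sg.Fn) (a : M.Env (Sg.fnArity f)) (b : M.carrier (Sg.fnSort f)) :
    b ∈ M.fn f a → toFun _ b ∈ N.fn f fun i => toFun _ (a i)
  map_rel (R : Sg.Rel) (a : M.Env (Sg.relArity R)) :
    a ∈ M.rel R → (fun i => toFun _ (a i)) ∈ N.rel R

instance : Category.{u} (PStr Sg) where
  Hom := PStr.Hom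
  id M := ⟨fun _ a => a, fun _ _ _ h => h, fun _ _ h => h⟩
  comp h k := ⟨fun s a => k.toFun s (h.toFun s a),
    fun f _ _ hb => k.map_fn f _ _ (h.map_fn f _ _ hb),
    fun R _ ha => k.map_rel R _ (h.map_rel R _ ha)⟩

/-- The property of being a partial model of `T`. -/
def IsModel (T : Theory Sg) : ObjectProperty (PStr Sg) :=
  fun M => ∀ σ ∈ T, M.Satisfies σ.hyp σ.concl

/-- The category of partial `T`-models, a full subcategory of that of partial structures. -/
abbrev PMod (T : Theory Sg) : Type (u + 1) := (IsModel T).FullSubcategory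

/-! Basic facts about interpretations, leading to soundness. -/

theorem Term.mem_eval_app (M : PStr Sg) {Γ : Ctx S} (m : M.Env Γ) (f : Sg.Fn)
    (ts : ∀ j : Fin (Sg.fnArity f).len, Term Sg Γ ((Sg.fnArity f).sort j))
    (b : M.carrier (Sg.fnSort f)) :
    b ∈ (Term.app f ts).eval M m ↔
      ∃ a : M.Env (Sg.fnArity f), (∀ j, a j ∈ (ts j).eval M m) ∧ b ∈ M.fn f a := by
  rw [Term.eval, Part.mem_bind_iff]
  constructor
  · rintro ⟨a, ⟨h, rfl⟩, hb⟩
    exact ⟨_, fun j => ⟨h j, rfl⟩, hb⟩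
  · rintro ⟨a, ha, hb⟩
    refine ⟨a, ⟨fun j => (ha j).1, ?_⟩, hb⟩
    funext j
    exact (ha j).2

theorem Horn.holds_rel (M : PStr Sg) {Γ : Ctx S} (m : M.Env Γ) (R : Sg.Rel)
    (ts : ∀ j : Fin (Sg.relArity R).len, Term Sg Γ ((Sg.relArity R).sort j)) :
    (Horn.rel R ts).holds M m ↔
      ∃ a : M.Env (Sg.relArity R), (∀ j, a j ∈ (ts j).eval M m) ∧ a ∈ M.rel R := by
  rw [Horn.holds]
  constructor
  · rintro ⟨h, ha⟩
    exact ⟨_, fun j => ⟨h j, rfl⟩, ha⟩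
  · rintro ⟨a, ha, hR⟩
    refine ⟨fun j => (ha j).1, ?_⟩
    have : (fun j => ((ts j).eval M m).get (ha j).1) = a := funext fun j => (ha j).2
    rw [this]
    exact hR

theorem Horn.holds_eq (M : PStr Sg) {Γ : Ctx S} (m : M.Env Γ) {s : S} (t t' : Term Sg Γ s) :
    (Horn.eq t t').holds M m ↔ ∃ b, b ∈ t.eval M m ∧ b ∈ t'.eval M m := by
  rw [Horn.holds]
  constructor
  · rintro ⟨h, h', e⟩
    exact ⟨_, ⟨h, rfl⟩, ⟨h', e.symm⟩⟩
  · rintro ⟨b, ⟨h, e⟩, ⟨h', e'⟩⟩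
    exact ⟨h, h', e.trans e'.symm⟩

theorem Term.holds_defined (M : PStr Sg) {Γ : Ctx S} (m : M.Env Γ) {s : S} (t : Term Sg Γ s) :
    t.defined.holds M m ↔ ∃ b, b ∈ t.eval M m := by
  rw [Term.defined, Horn.holds_eq]
  simp

theorem Horn.holds_conj (M : PStr Sg) {Γ : Ctx S} (m : M.Env Γ) {n : ℕ} (φ : Fin n → Horn Sg Γ) :
    (Horn.conj φ).holds M m ↔ ∀ i, (φ i).holds M m := by
  rw [Horn.holds]

theorem Horn.holds_and (M : PStr Sg) {Γ : Ctx S} (m : M.Env Γ) (φ ψ : Horn Sg Γ) :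
    (φ.and ψ).holds M m ↔ φ.holds M m ∧ ψ.holds M m := by
  rw [Horn.and, Horn.holds_conj, Fin.forall_fin_two]
  rfl

theorem Term.eval_subst (M : PStr Sg) {Γ Δ : Ctx S} (m : M.Env Δ)
    (τ : ∀ i : Fin Γ.len, Term Sg Δ (Γ.sort i)) (a : M.Env Γ) (ha : ∀ i, a i ∈ (τ i).eval M m)
    {s : S} (t : Term Sg Γ s) : (t.subst τ).eval M m = t.eval M a := by
  induction t with
  | var i h =>
    subst h
    rw [Term.subst, Term.eval]
    exact Part.eq_some_iff.2 (ha i)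
  | app f ts ih =>
    rw [Term.subst]
    ext b
    rw [Term.mem_eval_app, Term.mem_eval_app]
    simp only [ih]

theorem Horn.holds_subst (M : PStr Sg) {Γ Δ : Ctx S} (m : M.Env Δ)
    (τ : ∀ i : Fin Γ.len, Term Sg Δ (Γ.sort i)) (a : M.Env Γ) (ha : ∀ i, a i ∈ (τ i).eval M m)
    (φ : Horn Sg Γ) : (φ.subst τ).holds M m ↔ φ.holds M a := by
  induction φ with
  | rel R ts =>
    rw [Horn.subst, Horn.holds_rel, Horn.holds_rel]
    simp only [Term.eval_subst M m τ a ha]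
  | eq t t' =>
    rw [Horn.subst, Horn.holds_eq, Horn.holds_eq]
    simp only [Term.eval_subst M m τ a ha]
  | conj φ ih =>
    rw [Horn.subst, Horn.holds_conj, Horn.holds_conj]
    simp only [ih]

/-- Soundness of partial Horn logic. -/
theorem Provable.sound {T : Theory Sg} {M : PStr Sg} (hM : IsModel T M) {Γ : Ctx S}
    {φ ψ : Horn Sg Γ} (h : Provable T φ ψ) : M.Satisfies φ ψ := by
  induction h with
  | ax σ h => exact hM σ h
  | id φ => exact fun _ h => h
  | cut _ _ ih₁ ih₂ => exact fun m h => ih₂ m (ih₁ m h)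
  | subst τ _ ih =>
    intro m h
    rw [Horn.holds_and, allDefined, Horn.holds_conj] at h
    have h₂ := h.2
    simp only [Term.holds_defined] at h₂
    choose a ha using h₂
    rw [Horn.holds_subst M m τ a ha] at h ⊢
    exact ih a h.1
  | refl i =>
    intro m _
    rw [Term.holds_defined]
    exact ⟨m i, by rw [Term.eval]; exact Part.mem_some _⟩
  | eq φ x y _ _ sx sy =>
    intro m h
    rw [Horn.holds_and, Horn.holds_conj] at h
    have h₂ := h.2
    simp only [Horn.holds_eq] at h₂
    choose a hx hy using h₂
    rw [Horn.holds_subst M m _ a hx] at h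
    rw [Horn.holds_subst M m _ a hy]
    exact h.1
  | srel R ts j =>
    intro m h
    rw [Horn.holds_rel] at h
    obtain ⟨a, ha, _⟩ := h
    exact (Term.holds_defined M m _).2 ⟨_, ha j⟩
  | seqLeft t t' =>
    intro m h
    obtain ⟨b, hb, _⟩ := (Horn.holds_eq M m _ _).1 h
    exact (Term.holds_defined M m _).2 ⟨b, hb⟩
  | seqRight t t' =>
    intro m h
    obtain ⟨b, _, hb⟩ := (Horn.holds_eq M m _ _).1 h
    exact (Term.holds_defined M m _).2 ⟨b, hb⟩
  | sfun f ts j =>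
    intro m h
    obtain ⟨b, hb⟩ := (Term.holds_defined M m _).1 h
    obtain ⟨a, ha, _⟩ := (Term.mem_eval_app M m f ts b).1 hb
    exact (Term.holds_defined M m _).2 ⟨_, ha j⟩
  | econj φ j => exact fun m h => (Horn.holds_conj M m φ).1 h j
  | iconj _ ih => exact fun m h => (Horn.holds_conj M m _).2 fun i => ih i m h

/-- Homomorphisms preserve values of terms. -/
theorem PStr.Hom.map_eval {M N : PStr Sg} (h : PStr.Hom M N) {Γ : Ctx S} (m : M.Env Γ) {s : S}
    (t : Term Sg Γ s) (b : M.carrier s) (hb : b ∈ t.eval M m) :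
    h.toFun s b ∈ t.eval N fun i => h.toFun _ (m i) := by
  induction t with
  | var i e =>
    subst e
    rw [Term.eval] at hb ⊢
    rw [Part.mem_some_iff] at hb ⊢
    rw [hb]
  | app f ts ih =>
    rw [Term.mem_eval_app] at hb ⊢
    obtain ⟨a, ha, hb⟩ := hb
    exact ⟨fun j => h.toFun _ (a j), fun j => ih j _ (ha j), h.map_fn f a b hb⟩

/-- Homomorphisms preserve Horn formulas. -/
theorem PStr.Hom.map_holds {M N : PStr Sg} (h : PStr.Hom M N) {Γ : Ctx S} (m : M.Env Γ)
    (φ : Horn Sg Γ) (hφ : φ.holds M m) : φ.holds N fun i => h.toFun _ (m i) := by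
  induction φ with
  | rel R ts =>
    rw [Horn.holds_rel] at hφ ⊢
    obtain ⟨a, ha, hR⟩ := hφ
    exact ⟨fun j => h.toFun _ (a j), fun j => h.map_eval m _ _ (ha j), h.map_rel R a hR⟩
  | eq t t' =>
    rw [Horn.holds_eq] at hφ ⊢
    obtain ⟨b, hb, hb'⟩ := hφ
    exact ⟨_, h.map_eval m _ _ hb, h.map_eval m _ _ hb'⟩
  | conj φ ih =>
    rw [Horn.holds_conj] at hφ ⊢
    exact fun i => ih i (hφ i)

end Semantics

/-! ### Theory morphisms and translation functors -/

/-- The data of a theory morphism: sorts go to sorts, function symbols to terms and relation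
symbols to Horn formulas, in the corresponding contexts. -/
structure Translation {S S' : Type u} (Sg : Signature S) (Sg' : Signature S') : Type u where
  sort : S → S'
  fn (f : Sg.Fn) : Term Sg' ((Sg.fnArity f).map sort) (sort (Sg.fnSort f))
  rel (R : Sg.Rel) : Horn Sg' ((Sg.relArity R).map sort)

section Translate

variable {S S' : Type u} {Sg : Signature S} {Sg' : Signature S'}

/-- The translation of a term, replacing function symbols by terms. -/
def Translation.term (ρ : Translation Sg Sg') {Γ : Ctx S} :
    {s : S} → Term Sg Γ s → Term Sg' (Γ.map ρ.sort) (ρ.sort s)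
  | _, .var i h => .var i (congrArg ρ.sort h)
  | _, .app f ts =>
      (ρ.fn f).subst (Γ := (Sg.fnArity f).map ρ.sort) fun j => ρ.term (ts j)

/-- The formula saying that the translations of all proper subterms of a term are defined.
(A term is undefined as soon as one of its subterms is, but the term assigned to a
function symbol need not contain all the variables of its context, so that this has to
be recorded separately.) -/
def Translation.strict (ρ : Translation Sg Sg') {Γ : Ctx S} :
    {s : S} → Term Sg Γ s → Horn Sg' (Γ.map ρ.sort)
  | _, .var _ _ => Horn.top
  | _, .app _ ts => .conj fun j => (ρ.strict (ts j)).and (ρ.term (ts j)).defined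

/-- The translation of a Horn formula: all symbols are replaced according to `ρ`, and
the translations of all terms that occur are required to be defined. -/
def Translation.horn (ρ : Translation Sg Sg') {Γ : Ctx S} :
    Horn Sg Γ → Horn Sg' (Γ.map ρ.sort)
  | .rel R ts => ((ρ.rel R).subst (Γ := (Sg.relArity R).map ρ.sort) fun j => ρ.term (ts j)).and
      (.conj fun j => (ρ.strict (ts j)).and (ρ.term (ts j)).defined)
  | .eq t t' => (Horn.eq (ρ.term t) (ρ.term t')).and ((ρ.strict t).and (ρ.strict t'))
  | .conj φ => .conj fun i => ρ.horn (φ i)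

/-- The `Sg`-structure obtained from an `Sg'`-structure by interpreting the symbols of `Sg` as the
terms and formulas assigned to them. -/
abbrev Translation.reduct (ρ : Translation Sg Sg') (M : PStr Sg') : PStr Sg where
  carrier s := M.carrier (ρ.sort s)
  fn f a := (ρ.fn f).eval M a
  rel R := {a | (ρ.rel R).holds M a}

theorem Translation.mem_eval_reduct (ρ : Translation Sg Sg') (M : PStr Sg') {Γ : Ctx S}
    (m : (ρ.reduct M).Env Γ) {s : S} (t : Term Sg Γ s) (b : M.carrier (ρ.sort s)) :
    b ∈ t.eval (ρ.reduct M) m ↔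
      (ρ.strict t).holds M (Γ := Γ.map ρ.sort) m ∧
        b ∈ (ρ.term t).eval M (Γ := Γ.map ρ.sort) m := by
  induction t with
  | var i h =>
    subst h
    rw [Term.eval, Translation.strict, Translation.term, Term.eval, Horn.top, Horn.holds_conj]
    exact ⟨fun h => ⟨fun i => i.elim0, h⟩, fun h => h.2⟩
  | app f ts ih =>
    rw [Term.mem_eval_app, Translation.strict, Translation.term, Horn.holds_conj]
    simp only [Horn.holds_and, Term.holds_defined]
    constructor
    · rintro ⟨a, ha, hb⟩
      have ha' := fun j => (ih j (a j)).1 (ha j)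
      refine ⟨fun j => ⟨(ha' j).1, a j, (ha' j).2⟩, ?_⟩
      rw [Term.eval_subst M (Γ := (Sg.fnArity f).map ρ.sort) (Δ := Γ.map ρ.sort) m _ a
        fun j => (ha' j).2]
      exact hb
    · rintro ⟨h, hb⟩
      choose h₁ a ha using h
      rw [Term.eval_subst M (Γ := (Sg.fnArity f).map ρ.sort) (Δ := Γ.map ρ.sort) m _ a
        fun j => ha j] at hb
      exact ⟨a, fun j => (ih j (a j)).2 ⟨h₁ j, ha j⟩, hb⟩

/-- A formula holds in the reduct exactly if its translation holds. -/
theorem Translation.holds_reduct (ρ : Translation Sg Sg') (M : PStr Sg') {Γ : Ctx S}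
    (m : (ρ.reduct M).Env Γ) (φ : Horn Sg Γ) :
    φ.holds (ρ.reduct M) m ↔ (ρ.horn φ).holds M (Γ := Γ.map ρ.sort) m := by
  induction φ with
  | rel R ts =>
    rw [Horn.holds_rel, Translation.horn, Horn.holds_and, Horn.holds_conj]
    simp only [Horn.holds_and, Term.holds_defined]
    constructor
    · rintro ⟨a, ha, hR⟩
      have ha' := fun j => (ρ.mem_eval_reduct M m (ts j) (a j)).1 (ha j)
      refine ⟨?_, fun j => ⟨(ha' j).1, a j, (ha' j).2⟩⟩
      rw [Horn.holds_subst M (Γ := (Sg.relArity R).map ρ.sort) (Δ := Γ.map ρ.sort) m _ a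
        fun j => (ha' j).2]
      exact hR
    · rintro ⟨hR, h⟩
      choose h₁ a ha using h
      rw [Horn.holds_subst M (Γ := (Sg.relArity R).map ρ.sort) (Δ := Γ.map ρ.sort) m _ a
        fun j => ha j] at hR
      exact ⟨a, fun j => (ρ.mem_eval_reduct M m (ts j) (a j)).2 ⟨h₁ j, ha j⟩, hR⟩
  | eq t t' =>
    rw [Horn.holds_eq, Translation.horn, Horn.holds_and, Horn.holds_and, Horn.holds_eq]
    constructor
    · rintro ⟨b, hb, hb'⟩
      have h₁ := (ρ.mem_eval_reduct M m t b).1 hb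
      have h₂ := (ρ.mem_eval_reduct M m t' b).1 hb'
      exact ⟨⟨b, h₁.2, h₂.2⟩, h₁.1, h₂.1⟩
    · rintro ⟨⟨b, hb, hb'⟩, h, h'⟩
      exact ⟨b, (ρ.mem_eval_reduct M m t b).2 ⟨h, hb⟩, (ρ.mem_eval_reduct M m t' b).2 ⟨h', hb'⟩⟩
  | conj φ ih =>
    rw [Horn.holds_conj, Translation.horn, Horn.holds_conj]
    exact forall_congr' fun i => ih i

/-- A theory morphism `T → T'`: a translation of the symbols under which the axioms of `T` become
theorems of `T'`. -/
structure TheoryMorphism (T : Theory Sg) (T' : Theory Sg') extends Translation Sg Sg' where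
  provable : ∀ σ ∈ T, Provable T' (toTranslation.horn σ.hyp) (toTranslation.horn σ.concl)

theorem TheoryMorphism.isModel_reduct {T : Theory Sg} {T' : Theory Sg'}
    (ρ : TheoryMorphism T T') {M : PStr Sg'} (hM : IsModel T' M) :
    IsModel T (ρ.reduct M) := by
  intro σ hσ m h
  rw [Translation.holds_reduct] at h ⊢
  exact (ρ.provable σ hσ).sound hM m h

/-- The translation functor `U^ρ`. -/
def TheoryMorphism.functor {T : Theory Sg} {T' : Theory Sg'} (ρ : TheoryMorphism T T') :
    PMod T' ⥤ PMod T where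
  obj M := ⟨ρ.reduct M.obj, ρ.isModel_reduct M.property⟩
  map {M N} h := ObjectProperty.homMk (show PStr.Hom (ρ.reduct M.obj) (ρ.reduct N.obj) from
    { toFun := fun s => PStr.Hom.toFun h.hom (ρ.sort s)
      map_fn := fun f a b hb => PStr.Hom.map_eval h.hom _ (ρ.fn f) b hb
      map_rel := fun R _ ha => PStr.Hom.map_holds h.hom _ (ρ.rel R) ha })

end Translate

/-! ### Closed monomorphisms, local retractions, filtered colimit elimination -/

/-- Closed monomorphisms of partial models: domains of function symbols and relations of the
source are the preimages of those of the target. -/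
structure IsClosedMono {S : Type u} {Sg : Signature S} {T : Theory Sg} {M N : PMod T}
    (h : M ⟶ N) : Prop where
  mono : Mono h
  fn (f : Sg.Fn) (a : M.obj.Env (Sg.fnArity f)) :
    (N.obj.fn f fun i => PStr.Hom.toFun h.hom _ (a i)).Dom → (M.obj.fn f a).Dom
  rel (R : Sg.Rel) (a : M.obj.Env (Sg.relArity R)) :
    (fun i => PStr.Hom.toFun h.hom _ (a i)) ∈ N.obj.rel R → a ∈ M.obj.rel R

/-- `ℵ₀`-local retractions: all morphisms from finitely presentable objects lift. -/
def IsLocalRetraction {C : Type (u + 1)} [Category.{u} C] {X Y : C} (p : X ⟶ Y) : Prop :=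
  ∀ (Γ : C) [IsFinitelyPresentable.{u} Γ] (f : Γ ⟶ Y), ∃ g : Γ ⟶ X, g ≫ p = f

/-- A finitary partial Horn theory `T` admits filtered colimit elimination if, for each finitary
theory morphism `ρ : T → T'`, each replete full subcategory of `PMod T'` that is closed under
small products, closed subobjects and `(U^ρ, ℵ₀)`-local retracts is closed under small filtered
colimits. -/
def AdmitsFilteredColimitElimination {S : Type u} {Sg : Signature S} (T : Theory Sg) : Prop :=
  ∀ {S' : Type u} {Sg' : Signature S'} (T' : Theory Sg') (ρ : TheoryMorphism T T')
    (E : ObjectProperty (PMod T')), E.IsClosedUnderIsomorphisms →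
    (∀ J : Type u, E.IsClosedUnderLimitsOfShape (Discrete J)) →
    (∀ (A B : PMod T') (m : A ⟶ B), IsClosedMono m → E B → E A) →
    (∀ (A B : PMod T') (p : A ⟶ B), IsLocalRetraction (ρ.functor.map p) → E A → E B) →
    ∀ (J : Type u) [SmallCategory J] [IsFiltered J], E.IsClosedUnderColimitsOfShape J

/-! ### The ascending chain condition and connected objects -/

/-- Two objects are strongly connected if there are morphisms in both directions. -/
def StronglyConnected {C : Type*} [Category* C] (X Y : C) : Prop :=
  Nonempty (X ⟶ Y) ∧ Nonempty (Y ⟶ X)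

/-- The ascending chain condition for a category: in each chain `X₀ ⟶ X₁ ⟶ ⋯` the objects are
eventually strongly connected to each other. -/
def SatisfiesACC (C : Type*) [Category* C] : Prop :=
  ∀ X : ℕ ⥤ C, ∃ N : ℕ, ∀ m n : ℕ, N ≤ m → N ≤ n → StronglyConnected (X.obj m) (X.obj n)

/-- Connected objects: `Hom(X, -)` preserves small coproducts. -/
def IsConnectedObject {C : Type (u + 1)} [Category.{u} C] (X : C) : Prop :=
  ∀ J : Type u, PreservesColimitsOfShape (Discrete J) (coyoneda.obj (op X))

/-- The property of being finitely presentable and connected. -/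
def isFPConnected (C : Type (u + 1)) [Category.{u} C] : ObjectProperty C :=
  fun X => IsFinitelyPresentable.{u} X ∧ IsConnectedObject X

/-- The morphism from the initial to the terminal object is a strong monomorphism. -/
def InitialToTerminalStrongMono (C : Type (u + 1)) [Category.{u} C] : Prop :=
  ∀ (I T : C) (hI : IsInitial I) (_ : IsTerminal T), StrongMono (hI.to T)

end PHL

/-! Suppose a chain of finitely presentable objects X_n never stabilizes up to strong connectedness.
Then for each j some X_n has no morphism to X_j. Let E consist of the objects that miss a morphism
from some X_n, or into which parallel morphisms from finitely presentable objects are equal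
(`chainProperty`). E is closed under isomorphisms, products, subobjects and local retracts, so
filtered colimit elimination, applied to the identity theory morphism, closes it under filtered
colimits.

The double X_j ⊔ X_j lies in E, because it maps to X_j by the codiagonal. Doubling preserves
colimits (`isColimitDouble`), so Y ⊔ Y lies in E for Y = colim X_n. Every X_n maps to Y ⊔ Y, so the
second alternative holds there: both injections Y → Y ⊔ Y agree after composition with each X_n → Y.
This is impossible if X_0 is connected (`IsConnectedObject.comp_doubleι_ne`). In general the colimit
injections are jointly epic, so the two injections agree and Y admits no distinct parallel morphisms
to any object. If 0 → 1 is a strong monomorphism, Y is then initial, and X_m → Y → X_n strongly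
connects the chain, a contradiction.

The equivalence for 0 → 1 rests on the remark that an object out of which parallel morphisms agree
is an epimorphic image of 0. One direction lifts 0 → X against 0 → 1; the other pushes an
epimorphism out along a morphism to 0.

The argument needs colimits and a terminal object of partial models. Colimits are built from closed
terms that are defined in every cocone, modulo equality in every cocone; a Horn formula holds there
exactly if it holds in all cocones (`holds_colimStr`), so the axioms are inherited. -/

namespace PHL

open CategoryTheory CategoryTheory.Limits Opposite

/-! ### Homomorphisms of partial models -/

section Hom

variable {S : Type u} {Sg : Signature S} {T : Theory Sg}

/-- The underlying homomorphism of partial structures. -/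
abbrev PMod.toHom {M N : PMod T} (h : M ⟶ N) : PStr.Hom M.obj N.obj := h.hom

/-- The morphism of partial models given by a homomorphism of partial structures. -/
abbrev PMod.ofHom {M N : PMod T} (h : PStr.Hom M.obj N.obj) : M ⟶ N :=
  ObjectProperty.homMk h

theorem PMod.hom_ext {M N : PMod T} {h k : M ⟶ N}
    (e : ∀ s x, (PMod.toHom h).toFun s x = (PMod.toHom k).toFun s x) : h = k :=
  ObjectProperty.hom_ext _ (PStr.Hom.ext (funext fun s => funext fun x => e s x))

end Hom

/-! ### Colimits of partial models -/

section Colimit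

variable {S : Type u} {Sg : Signature S} {T : Theory Sg} {J : Type u} [Category.{u} J]
  (F : J ⥤ PMod T)

/-- Closed terms over the elements of all `F.obj j` as constants. -/
inductive ColimTerm : S → Type u
  | gen {s : S} (j : J) (a : (F.obj j).obj.carrier s) : ColimTerm s
  | app (f : Sg.Fn) (ts : ∀ i : Fin (Sg.fnArity f).len, ColimTerm ((Sg.fnArity f).sort i)) :
      ColimTerm (Sg.fnSort f)

variable {F}

/-- The value of a closed term in the point of a cocone. -/
def ColimTerm.eval (c : Cocone F) : {s : S} → ColimTerm F s → Part (c.pt.obj.carrier s)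
  | _, .gen j a => Part.some ((PMod.toHom (c.ι.app j)).toFun _ a)
  | _, .app f ts =>
      Part.bind ⟨∀ i, ((ts i).eval c).Dom, fun h i => ((ts i).eval c).get (h i)⟩ (c.pt.obj.fn f)

theorem ColimTerm.mem_eval_app (c : Cocone F) (f : Sg.Fn)
    (ts : ∀ i : Fin (Sg.fnArity f).len, ColimTerm F ((Sg.fnArity f).sort i))
    (b : c.pt.obj.carrier (Sg.fnSort f)) :
    b ∈ (ColimTerm.app f ts).eval c ↔
      ∃ a : c.pt.obj.Env (Sg.fnArity f), (∀ i, a i ∈ (ts i).eval c) ∧ b ∈ c.pt.obj.fn f a := by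
  rw [ColimTerm.eval, Part.mem_bind_iff]
  constructor
  · rintro ⟨a, ⟨h, rfl⟩, hb⟩
    exact ⟨_, fun i => ⟨h i, rfl⟩, hb⟩
  · rintro ⟨a, ha, hb⟩
    exact ⟨a, ⟨fun i => (ha i).1, funext fun i => (ha i).2⟩, hb⟩

variable (F) in
/-- Two everywhere defined closed terms are identified if they have the same value in all
cocones. -/
def colimSetoid (s : S) : Setoid {t : ColimTerm F s // ∀ c, (t.eval c).Dom} where
  r t t' := ∀ c, (t.1.eval c).get (t.2 c) = (t'.1.eval c).get (t'.2 c)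
  iseqv := ⟨fun _ _ => rfl, fun h c => (h c).symm, fun h h' c => (h c).trans (h' c)⟩

variable (F) in
/-- The sorts of the colimit. -/
abbrev ColimCarrier (s : S) : Type u := Quotient (colimSetoid F s)

/-- The value of an element of the colimit in the point of a cocone. -/
def ColimCarrier.val (c : Cocone F) (s : S) : ColimCarrier F s → c.pt.obj.carrier s :=
  Quotient.lift (fun t => (t.1.eval c).get (t.2 c)) fun _ _ h => h c

theorem ColimCarrier.ext {s : S} {x y : ColimCarrier F s} (h : ∀ c, x.val c = y.val c) :
    x = y := by
  induction x using Quotient.inductionOn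
  induction y using Quotient.inductionOn
  exact Quotient.sound h

theorem ColimCarrier.val_mem_eval_out {s : S} (x : ColimCarrier F s) (c : Cocone F) :
    x.val c ∈ x.out.1.eval c := by
  have e : (x.out.1.eval c).get (x.out.2 c) = x.val c := congrArg (ColimCarrier.val c s) x.out_eq
  exact e ▸ Part.get_mem (x.out.2 c)

/-- This makes the choice of representatives in `colimStr` harmless: the value of a compound term in
a cocone depends only on the values of its arguments there. -/
theorem ColimCarrier.mem_eval_app_out (c : Cocone F) (f : Sg.Fn)
    (a : ∀ i, ColimCarrier F ((Sg.fnArity f).sort i)) (b : c.pt.obj.carrier (Sg.fnSort f)) :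
    b ∈ (ColimTerm.app f fun i => (a i).out.1).eval c ↔
      b ∈ c.pt.obj.fn f fun i => (a i).val c := by
  rw [ColimTerm.mem_eval_app]
  constructor
  · rintro ⟨a', ha', hb⟩
    rwa [funext fun i => Part.mem_unique (ha' i) ((a i).val_mem_eval_out c)] at hb
  · exact fun hb => ⟨_, fun i => (a i).val_mem_eval_out c, hb⟩

variable (F) in
/-- The partial structure underlying the colimit. -/
noncomputable def colimStr : PStr Sg where
  carrier := ColimCarrier F
  fn f a :=
    { Dom := ∀ c : Cocone F, (c.pt.obj.fn f fun i => (a i).val c).Dom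
      get := fun h => Quotient.mk _ ⟨ColimTerm.app f fun i => (a i).out.1, fun c =>
        ((ColimCarrier.mem_eval_app_out c f a _).2 (Part.get_mem (h c))).1⟩ }
  rel R := {a | ∀ c : Cocone F, (fun i => (a i).val c) ∈ c.pt.obj.rel R}

theorem mem_colimStr_fn (f : Sg.Fn) (a : (colimStr F).Env (Sg.fnArity f))
    (b : ColimCarrier F (Sg.fnSort f)) :
    b ∈ (colimStr F).fn f a ↔ ∀ c, b.val c ∈ c.pt.obj.fn f fun i => (a i).val c := by
  have key : ∀ (h : ((colimStr F).fn f a).Dom) (c : Cocone F),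
      ColimCarrier.val c _ (((colimStr F).fn f a).get h) ∈
        c.pt.obj.fn f fun i => (a i).val c := fun h c =>
    (ColimCarrier.mem_eval_app_out c f a _).1 (Part.get_mem _)
  constructor
  · rintro ⟨h, rfl⟩ c
    exact key h c
  · intro h
    have hd : ((colimStr F).fn f a).Dom := fun c => (h c).1
    exact ⟨hd, ColimCarrier.ext fun c => Part.mem_unique (key hd c) (h c)⟩

/-- Evaluation in the point of a cocone is a homomorphism. -/
def colimVal (c : Cocone F) : PStr.Hom (colimStr F) c.pt.obj where
  toFun := ColimCarrier.val c
  map_fn f a b h := (mem_colimStr_fn f a b).1 h c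
  map_rel _ _ h := h c

/-- Definedness in all cocones separately yields one value in the colimit: by induction the subterms
have values, whose images in each cocone are the unique values there, and the domain of a function
symbol in `colimStr` was defined cocone by cocone. -/
theorem exists_mem_eval_colimStr {Γ : Ctx S} (m : (colimStr F).Env Γ) {s : S} (t : Term Sg Γ s)
    (h : ∀ c : Cocone F, (t.eval c.pt.obj fun i => (colimVal c).toFun _ (m i)).Dom) :
    ∃ b, b ∈ t.eval (colimStr F) m := by
  induction t with
  | var i e => exact ⟨_, Part.mem_some _⟩
  | app f ts ih =>
    have h' := fun c => (Term.mem_eval_app _ _ f ts _).1 (Part.get_mem (h c))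
    choose a ha ha' using h'
    choose b hb using fun j => ih j fun c => (ha c j).1
    have e : ∀ c, a c = fun j => (colimVal c).toFun _ (b j) := fun c => funext fun j =>
      Part.mem_unique (ha c j) ((colimVal c).map_eval _ _ _ (hb j))
    have hd : ((colimStr F).fn f b).Dom := fun c => by
      have := (ha' c).1
      rw [e] at this
      exact this
    exact ⟨_, (Term.mem_eval_app _ _ f ts _).2 ⟨b, hb, Part.get_mem hd⟩⟩

/-- A Horn formula holds in the colimit exactly if it holds in all cocones. -/
theorem holds_colimStr {Γ : Ctx S} (m : (colimStr F).Env Γ) (φ : Horn Sg Γ) :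
    φ.holds (colimStr F) m ↔
      ∀ c : Cocone F, φ.holds c.pt.obj fun i => (colimVal c).toFun _ (m i) := by
  refine ⟨fun h c => (colimVal c).map_holds m φ h, fun h => ?_⟩
  induction φ with
  | rel R ts =>
    choose a ha hR using fun c => (Horn.holds_rel _ _ R ts).1 (h c)
    choose b hb using fun j => exists_mem_eval_colimStr m (ts j) fun c => (ha c j).1
    have e : ∀ c, a c = fun j => (colimVal c).toFun _ (b j) := fun c => funext fun j =>
      Part.mem_unique (ha c j) ((colimVal c).map_eval _ _ _ (hb j))
    refine (Horn.holds_rel _ _ R ts).2 ⟨b, hb, fun c => ?_⟩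
    have := hR c
    rw [e] at this
    exact this
  | eq t t' =>
    choose b hb hb' using fun c => (Horn.holds_eq _ _ t t').1 (h c)
    obtain ⟨x, hx⟩ := exists_mem_eval_colimStr m t fun c => (hb c).1
    obtain ⟨y, hy⟩ := exists_mem_eval_colimStr m t' fun c => (hb' c).1
    have e : x = y := ColimCarrier.ext fun c =>
      (Part.mem_unique ((colimVal c).map_eval _ _ _ hx) (hb c)).trans
        (Part.mem_unique (hb' c) ((colimVal c).map_eval _ _ _ hy))
    exact (Horn.holds_eq _ _ t t').2 ⟨x, hx, e ▸ hy⟩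
  | conj φ ih =>
    exact (Horn.holds_conj _ _ φ).2 fun i => ih i fun c => (Horn.holds_conj _ _ φ).1 (h c) i

variable (F) in
/-- The colimit of `F` as a partial model. -/
noncomputable def colimObj : PMod T :=
  ⟨colimStr F, fun σ hσ m h => (holds_colimStr m _).2 fun c =>
    c.pt.property σ hσ _ ((holds_colimStr m _).1 h c)⟩

variable (F) in
/-- The colimit cocone of `F`. -/
noncomputable def colimCocone : Cocone F where
  pt := colimObj F
  ι :=
    { app := fun j => PMod.ofHom (N := colimObj F)
        { toFun := fun s a =>
            (Quotient.mk _ ⟨ColimTerm.gen j a, fun _ => trivial⟩ : ColimCarrier F s)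
          map_fn := fun f _ _ h => (mem_colimStr_fn f _ _).2 fun c =>
            (PMod.toHom (c.ι.app j)).map_fn f _ _ h
          map_rel := fun R _ h c => (PMod.toHom (c.ι.app j)).map_rel R _ h }
      naturality := fun _ _ g => PMod.hom_ext fun s x => ColimCarrier.ext fun c =>
        congrArg (fun h => (PMod.toHom h).toFun s x) (c.w g) }

/-- Uniqueness of the factorization: the colimit is generated by the elements of the diagram under
the function symbols, and a homomorphism preserves the values of these symbols. -/
theorem toFun_mk_colimStr (c : Cocone F) (h : PStr.Hom (colimStr F) c.pt.obj)
    (hh : ∀ j s a, h.toFun s ((PMod.toHom ((colimCocone F).ι.app j)).toFun s a) =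
      (PMod.toHom (c.ι.app j)).toFun s a) {s : S} (t : ColimTerm F s)
    (ht : ∀ c, (t.eval c).Dom) :
    h.toFun s (Quotient.mk (colimSetoid F s) ⟨t, ht⟩) =
      (colimVal c).toFun s (Quotient.mk (colimSetoid F s) ⟨t, ht⟩) := by
  induction t with
  | gen j a => exact hh j _ a
  | app f ts ih =>
    -- A compound term defined in every cocone has subterms defined in every cocone, so these
    -- represent elements of the colimit too.
    have hts : ∀ j c, ((ts j).eval c).Dom := fun j c => by
      obtain ⟨a, ha, _⟩ := (ColimTerm.mem_eval_app c f ts _).1 (Part.get_mem (ht c))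
      exact (ha j).1
    let a : (colimStr F).Env (Sg.fnArity f) := fun j =>
      (Quotient.mk _ ⟨ts j, hts j⟩ : ColimCarrier F _)
    have hm : (Quotient.mk _ ⟨ColimTerm.app f ts, ht⟩ : ColimCarrier F _) ∈
        (colimStr F).fn f a := by
      refine (mem_colimStr_fn f a _).2 fun c => ?_
      obtain ⟨a', ha', hb⟩ := (ColimTerm.mem_eval_app c f ts _).1 (Part.get_mem (ht c))
      rwa [funext fun j => Part.mem_unique (ha' j) (Part.get_mem (hts j c))] at hb
    have h₁ := h.map_fn f a _ hm
    rw [funext fun j => ih j (hts j)] at h₁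
    exact Part.mem_unique h₁ ((colimVal c).map_fn f a _ hm)

variable (F) in
/-- The cocone `colimCocone F` is a colimit. -/
noncomputable def isColimitColimCocone : IsColimit (colimCocone F) where
  desc c := PMod.ofHom (M := colimObj F) (colimVal c)
  fac _ _ := rfl
  uniq c h hh := PMod.hom_ext fun s x => by
    induction x using Quotient.inductionOn with
    | h t =>
      exact toFun_mk_colimStr c (PMod.toHom h)
        (fun j s a => congrArg (fun h => (PMod.toHom h).toFun s a) (hh j)) t.1 t.2

/-- There is no size problem: cocones range over a larger universe, but in `ColimCarrier` they are
only quantified over inside propositions. -/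
instance : HasColimits (PMod T) where
  has_colimits_of_shape _ _ := { has_colimit F := ⟨⟨_, isColimitColimCocone F⟩⟩ }

end Colimit

/-! ### The terminal partial model -/

section Terminal

variable {S : Type u} {Sg : Signature S} (T : Theory Sg)

variable (Sg) in
/-- The partial structure with one element of each sort in which everything holds. -/
def unitStr : PStr Sg where
  carrier _ := PUnit
  fn _ _ := Part.some PUnit.unit
  rel _ := Set.univ

theorem mem_eval_unitStr {Γ : Ctx S} (m : (unitStr Sg).Env Γ) {s : S} (t : Term Sg Γ s) :
    PUnit.unit ∈ t.eval (unitStr Sg) m := by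
  induction t with
  | var i h => exact Part.mem_some _
  | app f ts ih =>
    exact (Term.mem_eval_app _ _ f ts _).2 ⟨fun _ => PUnit.unit, ih, Part.mem_some _⟩

theorem holds_unitStr {Γ : Ctx S} (m : (unitStr Sg).Env Γ) (φ : Horn Sg Γ) :
    φ.holds (unitStr Sg) m := by
  induction φ with
  | rel R ts =>
    exact (Horn.holds_rel _ _ R ts).2
      ⟨fun _ => PUnit.unit, fun j => mem_eval_unitStr m (ts j), trivial⟩
  | eq t t' =>
    exact (Horn.holds_eq _ _ t t').2 ⟨_, mem_eval_unitStr m t, mem_eval_unitStr m t'⟩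
  | conj φ ih => exact (Horn.holds_conj _ _ φ).2 ih

/-- The terminal partial model. -/
def unitObj : PMod T := ⟨unitStr Sg, fun _ _ m _ => holds_unitStr m _⟩

/-- The one-element model is terminal. -/
def isTerminalUnitObj : IsTerminal (unitObj T) :=
  IsTerminal.ofUniqueHom
    (fun _ => PMod.ofHom (N := unitObj T)
      { toFun := fun _ _ => PUnit.unit
        map_fn := fun _ _ _ _ => Part.mem_some _
        map_rel := fun _ _ _ => trivial })
    fun _ _ => PMod.hom_ext fun _ _ => rfl

instance : HasTerminal (PMod T) := (isTerminalUnitObj T).hasTerminal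

end Terminal

/-! ### The identity theory morphism -/

section Identity

variable {S : Type u} {Sg : Signature S} (T : Theory Sg)

variable (Sg) in
/-- The identity translation. -/
abbrev Translation.id : Translation Sg Sg where
  sort s := s
  fn f := .app f fun j => .var j rfl
  rel R := .rel R fun j => .var j rfl

theorem Translation.term_id {Γ : Ctx S} {s : S} (t : Term Sg Γ s) :
    (Translation.id Sg).term t = t := by
  induction t with
  | var i h => rfl
  | app f ts ih => exact congrArg (Term.app f) (funext ih)

variable {T}

theorem Provable.and_intro {Γ : Ctx S} {φ ψ χ : Horn Sg Γ} (h₁ : Provable T φ ψ)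
    (h₂ : Provable T φ χ) : Provable T φ (ψ.and χ) :=
  .iconj (Fin.forall_fin_two.2 ⟨h₁, h₂⟩)

theorem Provable.and_left {Γ : Ctx S} (φ ψ : Horn Sg Γ) : Provable T (φ.and ψ) φ :=
  .econj ![φ, ψ] 0

theorem Provable.top_intro {Γ : Ctx S} (φ : Horn Sg Γ) : Provable T φ Horn.top :=
  .iconj fun i => i.elim0

theorem Provable.strict_id {Γ : Ctx S} {s : S} (t : Term Sg Γ s) :
    Provable T (Γ := Γ) t.defined ((Translation.id Sg).strict t) := by
  induction t with
  | var i h => exact .top_intro _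
  | app f ts ih =>
    refine .iconj fun j => .and_intro (.cut (.sfun f ts j) (ih j)) ?_
    rw [Translation.term_id]
    exact .sfun f ts j

/-- The identity translation changes a formula only by adding definedness clauses for terms and
subterms, which strictness of relations, equality and function symbols already makes derivable. -/
theorem Provable.horn_id {Γ : Ctx S} (φ : Horn Sg Γ) :
    Provable T (Γ := Γ) φ ((Translation.id Sg).horn φ) ∧
      Provable T (Γ := Γ) ((Translation.id Sg).horn φ) φ := by
  induction φ with
  | rel R ts =>
    have e : ((Translation.id Sg).rel R).subst (Γ := (Sg.relArity R).map (Translation.id Sg).sort)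
        (fun j => (Translation.id Sg).term (ts j)) = Horn.rel R ts :=
      congrArg (Horn.rel R) (funext fun j => Translation.term_id (ts j))
    rw [Translation.horn, e]
    refine ⟨.and_intro (.id _) (.iconj fun j =>
      .and_intro (.cut (.srel R ts j) (.strict_id (ts j))) ?_), .and_left _ _⟩
    rw [Translation.term_id]
    exact .srel R ts j
  | eq t t' =>
    rw [Translation.horn, Translation.term_id, Translation.term_id]
    exact ⟨.and_intro (.id _) (.and_intro (.cut (.seqLeft t t') (.strict_id t))
      (.cut (.seqRight t t') (.strict_id t'))), .and_left _ _⟩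
  | conj φ ih =>
    rw [Translation.horn]
    exact ⟨.iconj fun i => .cut (.econj φ i) (ih i).1,
      .iconj fun i => .cut (.econj (fun i => (Translation.id Sg).horn (φ i)) i) (ih i).2⟩

variable (T)

/-- The identity theory morphism. -/
def TheoryMorphism.id : TheoryMorphism T T where
  toTranslation := Translation.id Sg
  provable σ hσ := .cut (Provable.horn_id σ.hyp).2 (.cut (.ax σ hσ) (Provable.horn_id σ.concl).1)

theorem Translation.mem_reduct_id_fn (M : PStr Sg) (f : Sg.Fn) (a : M.Env (Sg.fnArity f))
    (b : M.carrier (Sg.fnSort f)) :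
    b ∈ ((Translation.id Sg).reduct M).fn f a ↔ b ∈ M.fn f a := by
  refine (Term.mem_eval_app M (Γ := Sg.fnArity f) a f _ b).trans ⟨?_, fun h => ?_⟩
  · rintro ⟨a', ha', hb⟩
    rwa [funext fun j => Part.mem_some_iff.1 (ha' j)] at hb
  · exact ⟨a, fun j => Part.mem_some _, h⟩

theorem Translation.mem_reduct_id_rel (M : PStr Sg) (R : Sg.Rel) (a : M.Env (Sg.relArity R)) :
    a ∈ ((Translation.id Sg).reduct M).rel R ↔ a ∈ M.rel R := by
  refine (Horn.holds_rel M (Γ := Sg.relArity R) a R _).trans ⟨?_, fun h => ?_⟩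
  · rintro ⟨a', ha', hb⟩
    rwa [funext fun j => Part.mem_some_iff.1 (ha' j)] at hb
  · exact ⟨a, fun j => Part.mem_some _, h⟩

/-- The translation functor of the identity theory morphism is isomorphic to the identity. -/
def TheoryMorphism.idFunctorIso : (TheoryMorphism.id T).functor ≅ 𝟭 (PMod T) :=
  NatIso.ofComponents
    (fun M =>
      { hom := PMod.ofHom (M := (TheoryMorphism.id T).functor.obj M) (N := M)
          { toFun := fun _ a => a
            map_fn := fun f a b => (Translation.mem_reduct_id_fn M.obj f a b).1
            map_rel := fun R a => (Translation.mem_reduct_id_rel M.obj R a).1 }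
        inv := PMod.ofHom (M := M) (N := (TheoryMorphism.id T).functor.obj M)
          { toFun := fun _ a => a
            map_fn := fun f a b => (Translation.mem_reduct_id_fn M.obj f a b).2
            map_rel := fun R a => (Translation.mem_reduct_id_rel M.obj R a).2 }
        hom_inv_id := rfl
        inv_hom_id := rfl })
    fun _ => rfl

end Identity

/-! ### Local retractions and subcategories given by an ascending chain -/

section Category

/-- This moves local retractions along `TheoryMorphism.idFunctorIso`: the reduct along the identity
interprets a symbol by evaluating it at variables, so it is compared with the model by an
isomorphism. -/
theorem IsLocalRetraction.of_iso {C : Type (u + 1)} [Category.{u} C] {X Y X' Y' : C} {p : X ⟶ Y}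
    (hp : IsLocalRetraction p) {q : X' ⟶ Y'} (e : X ≅ X') (e' : Y ≅ Y')
    (w : p ≫ e'.hom = e.hom ≫ q) : IsLocalRetraction q := by
  intro Γ _ f
  obtain ⟨g, hg⟩ := hp Γ (f ≫ e'.inv)
  refine ⟨g ≫ e.hom, ?_⟩
  rw [Category.assoc, ← w, reassoc_of% hg, Iso.inv_hom_id, Category.comp_id]

/-- The objects that do not admit morphisms from all members of the family `X`, or into which
any two parallel morphisms from a finitely presentable object are equal. -/
def chainProperty {C : Type (u + 1)} [Category.{u} C] (X : ℕ → C) : ObjectProperty C := fun M =>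
  (∃ n, IsEmpty (X n ⟶ M)) ∨
    ∀ (Γ : C) [IsFinitelyPresentable.{u} Γ] (f g : Γ ⟶ M), f = g

variable {C : Type (u + 1)} [Category.{u} C] (X : ℕ → C)

theorem chainProperty_of_mono {A B : C} (m : A ⟶ B) [Mono m] (h : chainProperty X B) :
    chainProperty X A := by
  obtain ⟨n, hn⟩ | h := h
  · exact .inl ⟨n, ⟨fun f => hn.false (f ≫ m)⟩⟩
  · exact .inr fun Γ _ f g => (cancel_mono m).1 (h Γ (f ≫ m) (g ≫ m))

instance : (chainProperty X).IsClosedUnderIsomorphisms where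
  of_iso e h := chainProperty_of_mono X e.inv h

/-- If some factor misses a morphism from some X_n, so does the product. Otherwise every factor
satisfies the second alternative, which can be checked on projections. -/
instance (J : Type*) : (chainProperty X).IsClosedUnderLimitsOfShape (Discrete J) where
  limitsOfShape_le := by
    rintro A ⟨p⟩
    by_cases hp : ∃ j n, IsEmpty (X n ⟶ p.diag.obj j)
    · obtain ⟨j, n, hn⟩ := hp
      exact .inl ⟨n, ⟨fun f => hn.false (f ≫ p.π.app j)⟩⟩
    · push Not at hp
      refine .inr fun Γ _ f g => p.isLimit.hom_ext fun j => ?_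
      obtain ⟨n, hn⟩ | h := p.prop_diag_obj j
      · exact (not_isEmpty_iff.2 (hp j n) hn).elim
      · exact h Γ _ _

/-- Both alternatives speak of morphisms out of finitely presentable objects only, and exactly these
lift along a local retraction. -/
theorem chainProperty_of_isLocalRetraction [∀ n, IsFinitelyPresentable.{u} (X n)] {A B : C}
    {p : A ⟶ B} (hp : IsLocalRetraction p) (h : chainProperty X A) : chainProperty X B := by
  obtain ⟨n, hn⟩ | h := h
  · exact .inl ⟨n, ⟨fun f => hn.false (hp (X n) f).choose⟩⟩
  · refine .inr fun Γ _ f g => ?_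
    obtain ⟨f', rfl⟩ := hp Γ f
    obtain ⟨g', rfl⟩ := hp Γ g
    rw [h Γ f' g']

end Category

/-! ### Coproducts of two copies of an object -/

section Copower

variable {C : Type (u + 1)} [Category.{u} C] [HasColimits C]

/-- The coproduct of two copies of an object. -/
noncomputable abbrev double (X : C) : C := ∐ fun _ : ULift.{u} Bool => X

/-- The two coproduct injections. -/
noncomputable abbrev doubleι (X : C) (b : Bool) : X ⟶ double X :=
  Sigma.ι (fun _ : ULift.{u} Bool => X) ⟨b⟩

theorem doubleι_ne_of_ne {X Y : C} {f g : X ⟶ Y} (h : f ≠ g) :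
    doubleι X true ≠ doubleι X false := by
  intro e
  have := congrArg (· ≫ Sigma.desc fun b : ULift.{u} Bool => cond b.down f g) e
  simp only [colimit.ι_desc, Cofan.mk_ι_app, cond_true, cond_false] at this
  exact h this

/-- Connectedness makes Hom(X, Y ⊔ Y) a disjoint union of two copies of Hom(X, Y), and the two
composites lie in different copies. -/
theorem IsConnectedObject.comp_doubleι_ne {X : C} (hX : IsConnectedObject X) {Y : C}
    (f : X ⟶ Y) : f ≫ doubleι Y true ≠ f ≫ doubleι Y false := by
  intro e
  have := hX (ULift.{u} Bool)
  let F : Discrete (ULift.{u} Bool) ⥤ C := Discrete.functor fun _ => Y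
  have hc := isColimitOfPreserves (coyoneda.obj (op X)) (colimit.isColimit F)
  -- The cocone that records which copy a morphism comes from; its induced map separates the two
  -- composites.
  let s : Cocone (F ⋙ coyoneda.obj (op X)) :=
    { pt := ULift.{u} Bool
      ι := Discrete.natTrans fun b => ↾fun _ => b.as }
  have h := fun b : ULift.{u} Bool => ConcreteCategory.congr_hom (hc.fac s ⟨b⟩) f
  have h' := (h ⟨true⟩).symm.trans ((congrArg (hc.desc s) e).trans (h ⟨false⟩))
  exact Bool.noConfusion (congrArg ULift.down h')

/-- The action of `double` on morphisms. -/
noncomputable def doubleMap {X Y : C} (f : X ⟶ Y) : double X ⟶ double Y :=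
  Sigma.desc fun b => f ≫ Sigma.ι (fun _ : ULift.{u} Bool => Y) b

@[simp]
theorem ι_doubleMap {X Y : C} (f : X ⟶ Y) (b : ULift.{u} Bool) :
    Sigma.ι (fun _ : ULift.{u} Bool => X) b ≫ doubleMap f =
      f ≫ Sigma.ι (fun _ : ULift.{u} Bool => Y) b := by
  simp [doubleMap]

@[simp]
theorem ι_doubleMap_assoc {X Y Z : C} (f : X ⟶ Y) (b : ULift.{u} Bool) (g : double Y ⟶ Z) :
    Sigma.ι (fun _ : ULift.{u} Bool => X) b ≫ doubleMap f ≫ g =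
      f ≫ Sigma.ι (fun _ : ULift.{u} Bool => Y) b ≫ g := by
  rw [← Category.assoc, ι_doubleMap, Category.assoc]

variable (C) in
/-- The functor sending an object to the coproduct of two copies of it. -/
noncomputable def doubleFunctor : C ⥤ C where
  obj X := double X
  map f := doubleMap f
  map_id X := Limits.Sigma.hom_ext _ _ fun b => by simp
  map_comp f g := Limits.Sigma.hom_ext _ _ fun b => by simp

variable {J : Type*} [Category* J]

/-- One component of a cocone over a doubled diagram. -/
noncomputable def componentCocone {F : J ⥤ C} (s : Cocone (F ⋙ doubleFunctor C))
    (b : ULift.{u} Bool) : Cocone F where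
  pt := s.pt
  ι :=
    { app := fun j => Sigma.ι (fun _ : ULift.{u} Bool => F.obj j) b ≫ s.ι.app j
      naturality := fun j k f =>
        (ι_doubleMap_assoc (F.map f) b (s.ι.app k)).symm.trans
          ((congrArg (Sigma.ι (fun _ : ULift.{u} Bool => F.obj j) b ≫ ·) (s.w f)).trans
            (Category.comp_id _).symm) }

/-- Doubling preserves colimits. -/
noncomputable def isColimitDouble {F : J ⥤ C} {c : Cocone F} (hc : IsColimit c) :
    IsColimit ((doubleFunctor C).mapCocone c) where
  desc s := Sigma.desc fun b => hc.desc (componentCocone s b)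
  fac _ j := Limits.Sigma.hom_ext _ _ fun b =>
    (ι_doubleMap_assoc (c.ι.app j) b _).trans
      ((congrArg (c.ι.app j ≫ ·) (Sigma.ι_desc _ b)).trans (hc.fac _ j))
  uniq s m hm := Limits.Sigma.hom_ext _ _ fun b =>
    (hc.uniq (componentCocone s b) (Sigma.ι (fun _ : ULift.{u} Bool => c.pt) b ≫ m) fun j =>
      (ι_doubleMap_assoc (c.ι.app j) b m).symm.trans
        (congrArg (Sigma.ι (fun _ : ULift.{u} Bool => F.obj j) b ≫ ·) (hm j))).trans
      (Sigma.ι_desc (fun b => hc.desc (componentCocone s b)) b).symm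

end Copower

/-! ### The ascending chain condition -/

section Chain

variable {S : Type u} {Sg : Signature S} {T : Theory Sg}

/-- Under filtered colimit elimination, a chain of finitely presentable objects stabilizes up to
strong connectedness as soon as some of its morphisms to the doubled colimit are distinct. -/
theorem AdmitsFilteredColimitElimination.exists_stronglyConnected
    (hT : AdmitsFilteredColimitElimination T) (X : ℕ ⥤ PMod T)
    [∀ n, IsFinitelyPresentable.{u} (X.obj n)]
    (hX : ∀ Y : PMod T, ¬ (∀ m n, StronglyConnected (X.obj m) (X.obj n)) →
      ∀ c : ∀ n, X.obj n ⟶ Y, (∀ (Z : PMod T) (f g : Y ⟶ Z), (∀ n, c n ≫ f = c n ≫ g) → f = g) →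
        ∃ n, c n ≫ doubleι Y true ≠ c n ≫ doubleι Y false) :
    ∃ N : ℕ, ∀ m n : ℕ, N ≤ m → N ≤ n → StronglyConnected (X.obj m) (X.obj n) := by
  by_contra! hN
  have hle : ∀ m n, m ≤ n → Nonempty (X.obj m ⟶ X.obj n) := fun m n h => ⟨X.map (homOfLE h)⟩
  have hempty : ∀ N, ∃ n, IsEmpty (X.obj n ⟶ X.obj N) := by
    intro N
    obtain ⟨m, n, hm, hn, h⟩ := hN N
    obtain ⟨f⟩ := hle N m hm
    obtain ⟨g⟩ := hle N n hn
    -- If every object of the chain mapped to X_N, then X_m → X_N → X_n and X_n → X_N → X_m would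
    -- connect X_m and X_n.
    by_contra! h'
    exact h ⟨⟨(h' m).some ≫ g⟩, ⟨(h' n).some ≫ f⟩⟩
  -- The chain is reindexed by a copy of ℕ in `Type u`, the universe of the shapes in the closure
  -- hypothesis.
  let K : ULift.{u} ℕ ⥤ ℕ := Monotone.functor (f := ULift.down) fun _ _ h => h
  let E := chainProperty X.obj
  have hE : E.IsClosedUnderColimitsOfShape (ULift.{u} ℕ) :=
    hT T (TheoryMorphism.id T) E inferInstance (fun _ => inferInstance)
      (fun A B m hm hB => by have := hm.mono; exact chainProperty_of_mono X.obj m hB)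
      (fun A B p hp hA => chainProperty_of_isLocalRetraction X.obj
        (hp.of_iso ((TheoryMorphism.idFunctorIso T).app A) ((TheoryMorphism.idFunctorIso T).app B)
          ((TheoryMorphism.idFunctorIso T).hom.naturality p)) hA) _
  have hY : E (double (colimit (K ⋙ X))) := by
    refine E.prop_of_isColimit (F := K ⋙ X ⋙ doubleFunctor _)
      (c := (doubleFunctor _).mapCocone (colimit.cocone (K ⋙ X)))
      (isColimitDouble (colimit.isColimit (K ⋙ X))) fun j => ?_
    obtain ⟨n, hn⟩ := hempty j.down
    -- A morphism X_n → X_j ⊔ X_j would give X_n → X_j by the codiagonal.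
    exact .inl ⟨n, ⟨fun f => hn.false (f ≫ Sigma.desc fun _ => 𝟙 (X.obj j.down))⟩⟩
  let c : ∀ n, X.obj n ⟶ colimit (K ⋙ X) := fun n => colimit.ι (K ⋙ X) ⟨n⟩
  obtain ⟨n, hn⟩ | h := hY
  · exact hn.false (c n ≫ doubleι _ true)
  · obtain ⟨n, hn⟩ := hX _
      (fun h => by obtain ⟨m, n, -, -, h'⟩ := hN 0; exact h' (h m n)) c
      (fun Z f g e => colimit.hom_ext fun j => e j.down)
    exact hn (h _ _ _)

end Chain

/-! ### The morphism from the initial to the terminal object -/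

section Initial

variable {C : Type (u + 1)} [Category.{u} C]

/-- If the initial object has no proper epimorphic images, the morphism from the initial to the
terminal object is a strong monomorphism. -/
theorem initialToTerminalStrongMono_of_parallel [HasColimits C]
    (h : ∀ X : C, ¬ Nonempty (IsInitial X) → ∃ (Y : C) (f g : X ⟶ Y), f ≠ g) :
    InitialToTerminalStrongMono C := by
  intro I T hI hT
  -- The pushout of e along a is an epimorphic image of I, so parallel morphisms out of it agree and
  -- it is initial by hypothesis; B → pushout → I is the extension.
  have key : ∀ (A B : C) (e : A ⟶ B) [Epi e] (a : A ⟶ I), ∃ l : B ⟶ I, e ≫ l = a := by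
    intro A B e _ a
    have hP : Nonempty (IsInitial (pushout a e)) := by
      by_contra hP
      obtain ⟨Y, f, g, hfg⟩ := h _ hP
      exact hfg ((cancel_epi (pushout.inl a e)).1 (hI.hom_ext _ _))
    refine ⟨pushout.inr a e ≫ hP.some.to I, ?_⟩
    rw [← pushout.condition_assoc, hI.hom_ext (pushout.inl a e ≫ hP.some.to I) (𝟙 I),
      Category.comp_id]
  refine ⟨⟨fun {A} f g _ => ?_⟩, fun A B e _ => ⟨fun {a b} sq => ?_⟩⟩
  · have : Epi (codiag A) := (IsSplitEpi.mk' ⟨coprod.inl, coprod.inl_desc _ _⟩).epi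
    obtain ⟨l, hl⟩ := key _ _ (codiag A) (coprod.desc f g)
    have h₁ : f = l := by
      rw [← coprod.inl_desc f g, ← hl, coprod.inl_desc_assoc, Category.id_comp]
    have h₂ : g = l := by
      rw [← coprod.inr_desc f g, ← hl, coprod.inr_desc_assoc, Category.id_comp]
    exact h₁.trans h₂.symm
  · obtain ⟨l, hl⟩ := key A B e a
    exact ⟨⟨⟨l, hl, hT.hom_ext _ _⟩⟩⟩

/-- If parallel morphisms out of X always agree, 0 → X is epic. Lifting it against the strong
monomorphism 0 → 1 gives X → 0, which is inverse to it since endomorphisms of X agree as well. -/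
theorem exists_parallel_of_initialToTerminalStrongMono [HasInitial C] [HasTerminal C]
    (h : InitialToTerminalStrongMono C) (X : C) (hX : ¬ Nonempty (IsInitial X)) :
    ∃ (Y : C) (f g : X ⟶ Y), f ≠ g := by
  by_contra! hp
  have := h (⊥_ C) (⊤_ C) initialIsInitial terminalIsTerminal
  have : Epi (initial.to X) := ⟨fun f g _ => hp _ f g⟩
  have := StrongMono.rlp (f := initialIsInitial.to (⊤_ C)) (initial.to X)
  have sq : CommSq (𝟙 (⊥_ C)) (initial.to X) (initialIsInitial.to (⊤_ C)) (terminal.from X) :=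
    ⟨terminal.hom_ext _ _⟩
  exact hX ⟨initialIsInitial.ofIso
    ⟨initial.to X, sq.lift, initial.hom_ext _ _, hp _ _ _⟩⟩

end Initial

/-! ### The two chain conditions -/

section ACC

variable {S : Type u} {Sg : Signature S} {T : Theory Sg}

/-- Under filtered colimit elimination, the finitely presentable connected objects satisfy the
ascending chain condition. -/
theorem AdmitsFilteredColimitElimination.satisfiesACC_isFPConnected
    (hT : AdmitsFilteredColimitElimination T) :
    SatisfiesACC (isFPConnected (PMod T)).FullSubcategory := by
  intro X
  have (n : ℕ) : IsFinitelyPresentable.{u} ((X ⋙ ObjectProperty.ι _).obj n) :=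
    (X.obj n).property.1
  obtain ⟨N, hN⟩ := hT.exists_stronglyConnected (X ⋙ ObjectProperty.ι _)
    fun Y _ c _ => ⟨0, (X.obj 0).property.2.comp_doubleι_ne (c 0)⟩
  exact ⟨N, fun m n hm hn => ⟨(hN m n hm hn).1.map ObjectProperty.homMk,
    (hN m n hm hn).2.map ObjectProperty.homMk⟩⟩

/-- Under filtered colimit elimination, if the morphism from the initial to the terminal object is
a strong monomorphism, the finitely presentable objects satisfy the ascending chain condition. -/
theorem AdmitsFilteredColimitElimination.satisfiesACC_isFinitelyPresentable
    (hT : AdmitsFilteredColimitElimination T) (h : InitialToTerminalStrongMono (PMod T)) :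
    SatisfiesACC (ObjectProperty.isFinitelyPresentable.{u} (PMod T)).FullSubcategory := by
  intro X
  have (n : ℕ) : IsFinitelyPresentable.{u} ((X ⋙ ObjectProperty.ι _).obj n) :=
    (X.obj n).property
  obtain ⟨N, hN⟩ := hT.exists_stronglyConnected (X ⋙ ObjectProperty.ι _)
    fun Y hX c hc => by
      by_contra! hn
      obtain ⟨Z, f, g, hfg⟩ := exists_parallel_of_initialToTerminalStrongMono h Y
        -- An initial Y would connect all objects of the chain through X_m → Y → X_n.
        fun ⟨hY⟩ => hX fun m n => ⟨⟨c m ≫ hY.to _⟩, ⟨c n ≫ hY.to _⟩⟩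
      -- Joint epicness turns agreement of the injections on all X_k into equality on Y, whereas a
      -- distinct pair f, g out of Y keeps them apart.
      exact doubleι_ne_of_ne hfg (hc _ _ _ fun k => by simpa using hn k)
  exact ⟨N, fun m n hm hn => ⟨(hN m n hm hn).1.map ObjectProperty.homMk,
    (hN m n hm hn).2.map ObjectProperty.homMk⟩⟩

end ACC

end PHL

theorem mainTheorem6 {S : Type u} {Sg : PHL.Signature S} (T : PHL.Theory Sg)
    (hT : PHL.AdmitsFilteredColimitElimination T) :
    PHL.SatisfiesACC (PHL.isFPConnected (PHL.PMod T)).FullSubcategory ∧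
    (PHL.InitialToTerminalStrongMono (PHL.PMod T) ↔
      ∀ X : PHL.PMod T, ¬ Nonempty (CategoryTheory.Limits.IsInitial X) →
        ∃ (Y : PHL.PMod T) (f g : X ⟶ Y), f ≠ g) ∧
    (PHL.InitialToTerminalStrongMono (PHL.PMod T) →
      PHL.SatisfiesACC
        (CategoryTheory.ObjectProperty.isFinitelyPresentable.{u} (PHL.PMod T)).FullSubcategory) := by
  exact ⟨hT.satisfiesACC_isFPConnected, ⟨PHL.exists_parallel_of_initialToTerminalStrongMono,
    PHL.initialToTerminalStrongMono_of_parallel⟩, hT.satisfiesACC_isFinitelyPresentable⟩
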